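/- Let $\mathbb{F}_q$ be a finite field of characteristic $3$ and let $L/\mathbb{F}_q(x)$ be a separable cubic extension. Let $b\in\mathbb{F}_q(x)$ and let $z$ be a generator of $L/\mathbb{F}_q(x)$ with minimal polynomial $$X^3+bX+b^2$$ such that for every finite place $\mathfrak{q}$ of $\mathbb{F}_q(x)$ (i.e. every nonzero prime ideal of $\mathbb{F}_q[x]$), either $v_{\mathfrak q}(b)\ge 0$, or $v_{\mathfrak q}(b)<0$ and $\gcd(v_{\mathfrak q}(b),3)=1$. Write $$b=\frac{\xi_1\xi_2^2}{\beta},$$ where $\xi_1,\xi_2,\beta\in\mathbb{F}_q[x]$, $\beta\neq 0$, $\xi_1$ is square-free and $\gcd(\xi_1\xi_2,\beta)=1$. Let $(\partial_{L/\mathbb{F}_q(x)})_{\mathbb{F}_q[x]}$ denote the finite part of the discriminant, that is, the norm to $\mathbb{F}_q[x]$ of the different of the integral closure of $\mathbb{F}_q[x]$ in $L$. Then $$(\partial_{L/\mathbb{F}_q(x)})_{\mathbb{F}_q[x]}=\prod_{\mathfrak{p}\mid(\xi_1)_{\mathbb{F}_q[x]}}\mathfrak{p}\ \prod_{\mathfrak{p}\mid(\beta)_{\mathbb{F}_q[x]}}\mathfrak{p}^{-v_{\mathfrak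 p}(b)+2},$$ where the products run over the finite places $\mathfrak{p}$ dividing the indicated ideals. -/

import Mathlib

open scoped nonZeroDivisors Polynomial

namespace CubicFunctionField

open IsDedekindDomain

/-- The finite places of the rational function field `F(x)`: the nonzero prime ideals of `F[x]`. -/
abbrev FinitePlace (F : Type*) [Field F] : Type _ :=
  HeightOneSpectrum F[X]

/-- The normalised additive valuation `v_p : F(x)ˣ → ℤ` at a finite place `p`. Mathlib's
multiplicative valuation of `a` is `exp (-v_p(a))`. (At `a = 0` the value is `0` by convention.) -/
noncomputable def ord {F : Type*} [Field F] (p : FinitePlace F) (a : RatFunc F) : ℤ :=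
  -WithZero.log (p.valuation (RatFunc F) a)

/-- The finite set of finite places dividing the principal ideal `(f)`, for a nonzero polynomial
`f`. -/
noncomputable def placesDividing {F : Type*} [Field F] (f : F[X]) (hf : f ≠ 0) :
    Finset (FinitePlace F) :=
  (Ideal.finite_factors (I := Ideal.span {f})
    (fun h => hf (Ideal.span_singleton_eq_bot.mp h))).toFinset

theorem mem_placesDividing {F : Type*} [Field F] {f : F[X]} {hf : f ≠ 0} {p : FinitePlace F} :
    p ∈ placesDividing f hf ↔ p.asIdeal ∣ Ideal.span {f} := by
  simp [placesDividing]

instance ringOfIntegers_isTorsionFree {F L : Type*} [Field F] [Field L] [Algebra F[X] L]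
    [Algebra (RatFunc F) L] [IsScalarTower F[X] (RatFunc F) L] :
    Module.IsTorsionFree F[X] (FunctionField.ringOfIntegers F L) :=
  Module.isTorsionFree_iff_algebraMap_injective.mpr
    (FunctionField.ringOfIntegers.algebraMap_injective F L)

/-- The finite part of the discriminant of a finite separable extension `L / F(x)`: the relative
norm, an ideal of `F[x]`, of the different ideal of the integral closure of `F[x]` in `L`. -/
noncomputable def finiteDiscriminant (F L : Type*) [Field F] [Field L] [Algebra F[X] L]
    [Algebra (RatFunc F) L] [IsScalarTower F[X] (RatFunc F) L]
    [FiniteDimensional (RatFunc F) L] [Algebra.IsSeparable (RatFunc F) L] : Ideal F[X] :=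
  Ideal.relNorm F[X] (differentIdeal F[X] (FunctionField.ringOfIntegers F L))

end CubicFunctionField

/-! Both sides are compared prime by prime. Put `y = β z / ξ₂`, a root of `Y³ + ξ₁βY + ξ₁²ξ₂β`. For
a generator `w` integral over `A = F[x]`, the conductor of `A[w]` times the different is generated
by the derivative of the minimal polynomial at `w`. Taking norms bounds the discriminant of the
extension by that of the cubic, which in characteristic 3 is, up to sign, `c³ + 2a²c² + a³d`
(`relNorm_conductor_mul_relNorm_differentIdeal`). At each prime `π` it then suffices to choose `w`
well.

If `π ∤ ξ₁β`, the cubic of `y` has discriminant prime to `π`. If `π ∣ ξ₁`, a modified generator has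
a cubic with a double and a simple root modulo `π`. Ramification forces at least one factor `π`, and
the discriminant allows only one (`hasExponent_one_of_double_root`). If `π ∣ β`, the exponent `n` of
`π` in `β` is prime to 3, and rescaling `y` or its inverse gives an Eisenstein cubic. Then `A[w]` is
maximal at `π`, and its discriminant has exponent `n + 2` (`hasExponent_of_isEisenstein`). -/

namespace CubicFunctionField

/-! ### Norm, trace and discriminant of a cubic generator -/

section CubicElement

variable {K L : Type*} [Field K] [Field L] [Algebra K L]

/-- In an extension of degree three, every element outside the base field is a generator. -/
theorem adjoin_eq_top_of_finrank_eq_three (h3 : Module.finrank K L = 3) {x : L}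
    (hx : x ∉ (algebraMap K L).range) : Algebra.adjoin K {x} = ⊤ := by
  have : FiniteDimensional K L := Module.finite_of_finrank_pos (by omega)
  have hs : IsSimpleOrder (IntermediateField K L) :=
    IntermediateField.isSimpleOrder_of_finrank_prime K L (by rw [h3]; exact Nat.prime_three)
  rcases hs.eq_bot_or_eq_top (IntermediateField.adjoin K {x}) with h | h
  · rw [IntermediateField.adjoin_simple_eq_bot_iff, IntermediateField.mem_bot] at h
    exact (hx h).elim
  · rw [← IntermediateField.adjoin_simple_toSubalgebra_of_isAlgebraic
      (Algebra.IsAlgebraic.isAlgebraic x), h, IntermediateField.top_toSubalgebra]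

theorem minpoly_eq_cubic (h3 : Module.finrank K L = 3) {x : L}
    (hx : x ∉ (algebraMap K L).range) {a c d : K}
    (h : x ^ 3 + algebraMap K L a * x ^ 2 + algebraMap K L c * x + algebraMap K L d = 0) :
    minpoly K x = (⟨1, a, c, d⟩ : Cubic K).toPoly := by
  have : FiniteDimensional K L := Module.finite_of_finrank_pos (by omega)
  have hint : IsIntegral K x := Algebra.IsIntegral.isIntegral x
  have hdeg : (minpoly K x).natDegree = 3 := by
    have hp := (PowerBasis.ofAdjoinEqTop hint (adjoin_eq_top_of_finrank_eq_three h3 hx)).finrank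
    rw [h3] at hp
    simpa using hp.symm
  have hroot : Polynomial.aeval x (⟨1, a, c, d⟩ : Cubic K).toPoly = 0 := by
    simpa [Cubic.toPoly] using h
  have hmonic : (⟨1, a, c, d⟩ : Cubic K).toPoly.Monic := Cubic.monic_of_a_eq_one rfl
  refine symm <| Polynomial.eq_of_monic_of_dvd_of_natDegree_le (minpoly.monic hint) hmonic
    (minpoly.dvd K x hroot) ?_
  rw [hdeg]
  exact (Cubic.natDegree_of_a_ne_zero' one_ne_zero).le

theorem norm_eq_of_cubic (h3 : Module.finrank K L = 3) {x : L}
    (hx : x ∉ (algebraMap K L).range) {a c d : K}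
    (h : x ^ 3 + algebraMap K L a * x ^ 2 + algebraMap K L c * x + algebraMap K L d = 0) :
    Algebra.norm K x = -d := by
  have : FiniteDimensional K L := Module.finite_of_finrank_pos (by omega)
  have hint : IsIntegral K x := Algebra.IsIntegral.isIntegral x
  have := Algebra.PowerBasis.norm_gen_eq_coeff_zero_minpoly
    (PowerBasis.ofAdjoinEqTop hint (adjoin_eq_top_of_finrank_eq_three h3 hx))
  rw [← PowerBasis.finrank, h3, PowerBasis.ofAdjoinEqTop_gen, minpoly_eq_cubic h3 hx h,
    Cubic.coeff_eq_d] at this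
  rw [this]
  ring

theorem trace_eq_of_cubic (h3 : Module.finrank K L = 3) {x : L}
    (hx : x ∉ (algebraMap K L).range) {a c d : K}
    (h : x ^ 3 + algebraMap K L a * x ^ 2 + algebraMap K L c * x + algebraMap K L d = 0) :
    Algebra.trace K L x = -a := by
  have : FiniteDimensional K L := Module.finite_of_finrank_pos (by omega)
  have hint : IsIntegral K x := Algebra.IsIntegral.isIntegral x
  have := PowerBasis.trace_gen_eq_nextCoeff_minpoly
    (PowerBasis.ofAdjoinEqTop hint (adjoin_eq_top_of_finrank_eq_three h3 hx))
  rw [PowerBasis.ofAdjoinEqTop_gen, minpoly_eq_cubic h3 hx h,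
    Polynomial.nextCoeff_of_natDegree_pos (by rw [Cubic.natDegree_of_a_ne_zero' one_ne_zero]; omega),
    Cubic.natDegree_of_a_ne_zero' one_ne_zero, Cubic.coeff_eq_b] at this
  exact this

theorem aeval_derivative_minpoly_of_cubic [CharP K 3] (h3 : Module.finrank K L = 3) {x : L}
    (hx : x ∉ (algebraMap K L).range) {a c d : K}
    (h : x ^ 3 + algebraMap K L a * x ^ 2 + algebraMap K L c * x + algebraMap K L d = 0) :
    Polynomial.aeval x (minpoly K x).derivative = algebraMap K L c - algebraMap K L a * x := by
  have hL : CharP L 3 := charP_of_injective_algebraMap (algebraMap K L).injective 3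
  have h30 : (3 : L) = 0 := by exact_mod_cast CharP.cast_eq_zero L 3
  rw [minpoly_eq_cubic h3 hx h]
  simp [Cubic.toPoly, map_ofNat (algebraMap K L) 2]
  linear_combination (x ^ 2 + algebraMap K L a * x) * h30

/-- The norm of the derivative `c - a x` of the cubic polynomial of `x` in characteristic three. -/
theorem norm_derivative_of_cubic [CharP K 3] (h3 : Module.finrank K L = 3) {x : L}
    (hx : x ∉ (algebraMap K L).range) {a c d : K}
    (h : x ^ 3 + algebraMap K L a * x ^ 2 + algebraMap K L c * x + algebraMap K L d = 0) :
    Algebra.norm K (algebraMap K L c - algebraMap K L a * x) =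
      c ^ 3 + 2 * a ^ 2 * c ^ 2 + a ^ 3 * d := by
  by_cases ha : a = 0
  · subst ha
    simp [Algebra.norm_algebraMap, h3]
  have hL : CharP L 3 := charP_of_injective_algebraMap (algebraMap K L).injective 3
  have h30 : (3 : L) = 0 := by exact_mod_cast CharP.cast_eq_zero L 3
  have hx' : algebraMap K L c - algebraMap K L a * x ∉ (algebraMap K L).range := by
    rintro ⟨r, hr⟩
    refine hx ⟨(c - r) / a, ?_⟩
    rw [map_div₀, map_sub, hr, div_eq_iff ((map_ne_zero _).mpr ha)]
    ring
  -- Substituting `x = (c - X) / a` in the cubic gives the cubic of `c - a x`; its linear term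
  -- vanishes in characteristic 3.
  have := norm_eq_of_cubic h3 hx' (a := -a ^ 2) (c := 0)
    (d := -(c ^ 3 + 2 * a ^ 2 * c ^ 2 + a ^ 3 * d)) (by
      simp only [map_neg, map_pow, map_zero, map_add, map_mul, map_ofNat]
      linear_combination (-(algebraMap K L a) ^ 3) * h + (algebraMap K L a * x
        * (algebraMap K L a * x * algebraMap K L c - (algebraMap K L c) ^ 2
          + algebraMap K L a ^ 2 * algebraMap K L c) - algebraMap K L a ^ 2 *
          algebraMap K L c ^ 2) * h30)
  rw [this, neg_neg]

end CubicElement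

end CubicFunctionField

/-! ### Exponent of a prime in the norm of the different -/

namespace CubicFunctionField

/-- `I` is divisible by the prime ideal `p` exactly `n` times. -/
def HasExponent {A : Type*} [CommRing A] (p I : Ideal A) (n : ℕ) : Prop :=
  ∃ J J' : Ideal A, ¬ J ≤ p ∧ ¬ J' ≤ p ∧ J * I = p ^ n * J'

section LocalExponents

variable {A K L B : Type*} [CommRing A] [IsDedekindDomain A] [Field K] [Field L]
  [CommRing B] [IsDedekindDomain B] [Algebra A K] [Algebra A L] [Algebra A B] [Algebra K L]
  [Algebra B L] [IsScalarTower A K L] [IsScalarTower A B L] [IsFractionRing A K]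
  [IsIntegralClosure B A L]

omit [IsDedekindDomain A] [IsDedekindDomain B] [IsFractionRing A K] [IsIntegralClosure B A L] in
theorem cubic_algebraMap {a c d : A} {w : B}
    (h : w ^ 3 + algebraMap A B a * w ^ 2 + algebraMap A B c * w + algebraMap A B d = 0) :
    (algebraMap B L w) ^ 3 + algebraMap K L (algebraMap A K a) * (algebraMap B L w) ^ 2
      + algebraMap K L (algebraMap A K c) * algebraMap B L w
      + algebraMap K L (algebraMap A K d) = 0 := by
  have := congrArg (algebraMap B L) h
  simpa [← IsScalarTower.algebraMap_apply] using this

theorem minpoly_eq_cubic_of_integral (h3 : Module.finrank K L = 3) {a c d : A} {w : B}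
    (hw : algebraMap B L w ∉ (algebraMap K L).range)
    (h : w ^ 3 + algebraMap A B a * w ^ 2 + algebraMap A B c * w + algebraMap A B d = 0) :
    minpoly A w = (⟨1, a, c, d⟩ : Cubic A).toPoly := by
  apply Polynomial.map_injective (algebraMap A K) (IsFractionRing.injective A K)
  rw [← minpoly.isIntegrallyClosed_eq_field_fractions K L (IsIntegralClosure.isIntegral A L w),
    minpoly_eq_cubic h3 hw (cubic_algebraMap h)]
  simp [Cubic.toPoly]

variable [CharP K 3] [FiniteDimensional K L] [Algebra.IsSeparable K L]
  [Module.IsTorsionFree A B] [Module.Finite A B]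

/-- The conductor of a cubic generator times the different has norm the discriminant. -/
theorem relNorm_conductor_mul_relNorm_differentIdeal (h3 : Module.finrank K L = 3)
    {a c d : A} {w : B} (hw : algebraMap B L w ∉ (algebraMap K L).range)
    (h : w ^ 3 + algebraMap A B a * w ^ 2 + algebraMap A B c * w + algebraMap A B d = 0) :
    Ideal.relNorm A (conductor A w) * Ideal.relNorm A (differentIdeal A B) =
      Ideal.span {c ^ 3 + 2 * a ^ 2 * c ^ 2 + a ^ 3 * d} := by
  have hL : CharP L 3 := charP_of_injective_algebraMap (algebraMap K L).injective 3
  have h30 : (3 : L) = 0 := by exact_mod_cast CharP.cast_eq_zero L 3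
  rw [← map_mul, conductor_mul_differentIdeal A K L w (adjoin_eq_top_of_finrank_eq_three h3 hw),
    Ideal.relNorm_singleton, minpoly_eq_cubic_of_integral h3 hw h]
  congr 2
  apply IsFractionRing.injective A K
  rw [Algebra.algebraMap_intNorm (L := L)]
  have := norm_derivative_of_cubic h3 hw (cubic_algebraMap h)
  simp only [map_add, map_mul, map_pow, map_ofNat]
  rw [← this]
  congr 1
  simp [Cubic.toPoly, ← IsScalarTower.algebraMap_apply, map_ofNat (algebraMap A L) 2]
  linear_combination ((algebraMap B L w) ^ 2 + algebraMap A L a * algebraMap B L w) * h30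

theorem hasExponent_zero_of_discriminant_notMem (h3 : Module.finrank K L = 3) (p : Ideal A)
    {a c d : A} {w : B} (hw : algebraMap B L w ∉ (algebraMap K L).range)
    (h : w ^ 3 + algebraMap A B a * w ^ 2 + algebraMap A B c * w + algebraMap A B d = 0)
    (hd : c ^ 3 + 2 * a ^ 2 * c ^ 2 + a ^ 3 * d ∉ p) :
    HasExponent p (Ideal.relNorm A (differentIdeal A B)) 0 := by
  have key := relNorm_conductor_mul_relNorm_differentIdeal h3 hw h
  refine ⟨Ideal.relNorm A (conductor A w), Ideal.span {c ^ 3 + 2 * a ^ 2 * c ^ 2 + a ^ 3 * d},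
    fun hJ => hd ?_, fun hJ => hd ?_, by rw [pow_zero, one_mul, key]⟩
  · rw [← Ideal.span_singleton_le_iff_mem, ← key]
    exact Ideal.mul_le_left.trans hJ
  · rwa [← Ideal.span_singleton_le_iff_mem]

/-- Otherwise `w` is a unit modulo `π`, so `w²(w + a) ≡ 0` gives `w ≡ -a`. Since `a` has trace `3a =
0`, the trace `-a` of `w` equals that of `w + a`, a multiple of `π`, against `π ∤ a`. -/
theorem exists_isMaximal_mem_of_double_root (h3 : Module.finrank K L = 3)
    {π a c d : A} {w : B} (hw : algebraMap B L w ∉ (algebraMap K L).range)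
    (h : w ^ 3 + algebraMap A B a * w ^ 2 + algebraMap A B c * w + algebraMap A B d = 0)
    (ha : ¬ π ∣ a) (hc : π ∣ c) (hd : π ∣ d) :
    ∃ P : Ideal B, P.IsMaximal ∧ algebraMap A B π ∈ P ∧ w ∈ P := by
  by_cases htop : Ideal.span {algebraMap A B π, w} = ⊤
  · obtain ⟨x, t, hxt⟩ := Ideal.mem_span_pair.mp (htop ▸ Submodule.mem_top (x := (1 : B)))
    obtain ⟨c, rfl⟩ := hc
    obtain ⟨d, rfl⟩ := hd
    have hr : ∃ r : B, w + algebraMap A B a = π • r := by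
      -- Expand `(xπ + tw)² (w + a)`, where `xπ + tw = 1`, and replace `w²(w + a)` using the cubic.
      refine ⟨(2 * x * t * w + algebraMap A B π * x ^ 2) * (w + algebraMap A B a)
        - t ^ 2 * (algebraMap A B c * w + algebraMap A B d), ?_⟩
      rw [Algebra.smul_def]
      simp only [map_mul] at h
      linear_combination (-(w + algebraMap A B a)) * (x * algebraMap A B π + t * w + 1) * hxt
        + t ^ 2 * h
    obtain ⟨r, hr⟩ := hr
    refine (ha ?_).elim
    have htr : Algebra.intTrace A B w = -a := by
      apply IsFractionRing.injective A K
      rw [Algebra.algebraMap_intTrace (L := L), map_neg]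
      exact trace_eq_of_cubic h3 hw (cubic_algebraMap h)
    have htra : Algebra.intTrace A B (algebraMap A B a) = 0 := by
      apply IsFractionRing.injective A K
      rw [Algebra.algebraMap_intTrace (L := L), ← IsScalarTower.algebraMap_apply,
        IsScalarTower.algebraMap_apply A K L, Algebra.trace_algebraMap, h3]
      simp [show (3 : K) = 0 by exact_mod_cast CharP.cast_eq_zero K 3]
    have := congrArg (Algebra.intTrace A B) hr
    rw [map_add, htr, htra, map_smul, add_zero, smul_eq_mul] at this
    rw [← dvd_neg, this]
    exact dvd_mul_right _ _
  · obtain ⟨P, hP, hle⟩ := Ideal.exists_le_maximal _ htop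
    exact ⟨P, hP, hle (Ideal.subset_span (by simp)), hle (Ideal.subset_span (by simp))⟩

/-- If the cubic of `w` has a double root modulo `π`, at which `w` is as small as possible, then
the norm of the different is divisible exactly once by `π`. -/
theorem hasExponent_one_of_double_root (h3 : Module.finrank K L = 3)
    {π a c d : A} (hπ : Prime π) {w : B} (hw : algebraMap B L w ∉ (algebraMap K L).range)
    (h : w ^ 3 + algebraMap A B a * w ^ 2 + algebraMap A B c * w + algebraMap A B d = 0)
    (ha : ¬ π ∣ a) (hc : π ∣ c) (hd : π ∣ d) (hd2 : ¬ π ^ 2 ∣ d) :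
    HasExponent (Ideal.span {π}) (Ideal.relNorm A (differentIdeal A B)) 1 := by
  have hp0 : Ideal.span {π} ≠ ⊥ := by simpa using hπ.ne_zero
  have hpp : (Ideal.span {π}).IsPrime := (Ideal.span_singleton_prime hπ.ne_zero).mpr hπ
  have hpm : (Ideal.span {π}).IsMaximal := hpp.isMaximal hp0
  have key := relNorm_conductor_mul_relNorm_differentIdeal h3 hw h
  obtain ⟨P, hP, hπP, hwP⟩ := exists_isMaximal_mem_of_double_root h3 hw h ha hc hd
  obtain ⟨c, rfl⟩ := hc
  obtain ⟨d, rfl⟩ := hd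
  have hd' : ¬ π ∣ d := fun hd' => hd2 (by rw [pow_two]; exact mul_dvd_mul_left π hd')
  have hcomap : P.comap (algebraMap A B) = Ideal.span {π} := by
    refine (hpm.eq_of_le (Ideal.comap_ne_top _ hP.ne_top) ?_).symm
    rwa [Ideal.span_singleton_le_iff_mem]
  have hdP : algebraMap A B d ∉ P := fun hdP => hd' <| by
    rwa [← Ideal.mem_span_singleton, ← hcomap]
  have hsq : algebraMap A B π ∈ P ^ 2 := by
    refine (hP.isPrime.mul_mem_pow P (a := algebraMap A B d) ?_).resolve_left hdP
    have hw2 : w ^ 2 ∈ P ^ 2 := Ideal.pow_mem_pow hwP 2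
    have hπw : algebraMap A B π * w ∈ P ^ 2 := by
      rw [pow_two]; exact Ideal.mul_mem_mul hπP hwP
    have : algebraMap A B d * algebraMap A B π =
        -(w + algebraMap A B a) * w ^ 2 + -algebraMap A B c * (algebraMap A B π * w) := by
      simp only [map_mul] at h
      linear_combination h
    rw [this]
    exact add_mem (Ideal.mul_mem_left _ _ hw2) (Ideal.mul_mem_left _ _ hπw)
  have hfrac : IsFractionRing B L := IsIntegralClosure.isFractionRing_of_finite_extension A K L B
  -- `P` has ramification index at least 2, so it divides the different.
  have hdvd : P ∣ differentIdeal A B := by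
    have := pow_sub_one_dvd_differentIdeal_aux A K L (p := Ideal.span {π}) P two_ne_zero hp0 (by
      rw [Ideal.map_span, Set.image_singleton, Ideal.dvd_span_singleton]
      exact hsq)
    simpa using this
  have hle : Ideal.relNorm A (differentIdeal A B) ≤ Ideal.span {π} :=
    hcomap ▸ (Ideal.relNorm_le_comap A _).trans (Ideal.comap_mono (Ideal.le_of_dvd hdvd))
  obtain ⟨J, hJ⟩ := Ideal.dvd_iff_le.mpr hle
  -- After removing one `π`, the discriminant is `a³d` modulo `π`, hence prime to `π`.
  have hcancel : Ideal.relNorm A (conductor A w) * J =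
      Ideal.span {π ^ 2 * c ^ 3 + 2 * a ^ 2 * π * c ^ 2 + a ^ 3 * d} := by
    refine mul_left_cancel₀ (a := Ideal.span {π}) hp0 ?_
    rw [mul_left_comm, ← hJ, key, Ideal.span_singleton_mul_span_singleton]
    congr 2
    ring
  refine ⟨⊤, J, fun hJ' => hpm.ne_top (top_le_iff.mp hJ'), fun hJ' => ?_, ?_⟩
  · have hmem : π ^ 2 * c ^ 3 + 2 * a ^ 2 * π * c ^ 2 + a ^ 3 * d ∈ Ideal.span {π} := by
      rw [← Ideal.span_singleton_le_iff_mem, ← hcancel]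
      exact Ideal.mul_le_right.trans hJ'
    rw [Ideal.mem_span_singleton, add_comm, dvd_add_left
      (by exact ⟨π * c ^ 3 + 2 * a ^ 2 * c ^ 2, by ring⟩)] at hmem
    rcases hπ.dvd_or_dvd hmem with h' | h'
    · exact ha (hπ.dvd_of_dvd_pow h')
    · exact hd' h'
  · rw [Ideal.top_mul, pow_one, hJ]

/-- A generator with Eisenstein cubic at `π` computes the exponent of `π` in the norm of the
different. -/
theorem hasExponent_of_isEisenstein (h3 : Module.finrank K L = 3)
    {π a c d u : A} {m : ℕ} (hπ : Prime π) {w : B}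
    (hw : algebraMap B L w ∉ (algebraMap K L).range)
    (h : w ^ 3 + algebraMap A B a * w ^ 2 + algebraMap A B c * w + algebraMap A B d = 0)
    (ha : π ∣ a) (hc : π ∣ c) (hd : π ∣ d) (hd2 : ¬ π ^ 2 ∣ d)
    (hm : c ^ 3 + 2 * a ^ 2 * c ^ 2 + a ^ 3 * d = π ^ m * u) (hu : ¬ π ∣ u) :
    HasExponent (Ideal.span {π}) (Ideal.relNorm A (differentIdeal A B)) m := by
  have hp0 : Ideal.span {π} ≠ ⊥ := by simpa using hπ.ne_zero
  have hpp : (Ideal.span {π}).IsPrime := (Ideal.span_singleton_prime hπ.ne_zero).mpr hπ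
  have key := relNorm_conductor_mul_relNorm_differentIdeal h3 hw h
  have hint : IsIntegral A (algebraMap B L w) :=
    (IsIntegralClosure.isIntegral A L w).map (IsScalarTower.toAlgHom A B L)
  have hinj : Function.Injective (algebraMap B L) := IsIntegralClosure.algebraMap_injective B A L
  have heis : (minpoly A (algebraMap B L w)).IsEisensteinAt (Ideal.span {π}) := by
    rw [minpoly.algebraMap_eq hinj, minpoly_eq_cubic_of_integral h3 hw h]
    refine (Cubic.monic_of_a_eq_one rfl).isEisensteinAt_of_mem_of_notMem hpp.ne_top ?_ ?_
    · intro n hn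
      rw [Cubic.natDegree_of_a_ne_zero' one_ne_zero] at hn
      rw [Ideal.mem_span_singleton]
      interval_cases n <;> simpa
    · rwa [Ideal.span_singleton_pow, Ideal.mem_span_singleton, Cubic.coeff_eq_d]
  let pb : PowerBasis K L := PowerBasis.ofAdjoinEqTop (hint.tower_top (A := K))
    (adjoin_eq_top_of_finrank_eq_three h3 hw)
  have hgen : pb.gen = algebraMap B L w := PowerBasis.ofAdjoinEqTop_gen _ _
  have hadj : ∀ x : B, algebraMap B L x ∈ Algebra.adjoin A {algebraMap B L w} →
      x ∈ Algebra.adjoin A {w} := by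
    intro x hx
    have hmap := AlgHom.map_adjoin (IsScalarTower.toAlgHom A B L) {w}
    rw [Set.image_singleton, IsScalarTower.coe_toAlgHom'] at hmap
    rw [← hmap] at hx
    obtain ⟨y, hy, hyx⟩ := hx
    rwa [← hinj hyx]
  have hdisc : ∀ x : B, (π ^ m * u) • algebraMap B L x ∈
      Algebra.adjoin A {algebraMap B L w} := by
    intro x
    have hx := Algebra.discr_mul_isIntegral_mem_adjoin K (B := pb) (R := A) (by rwa [hgen])
      ((IsIntegralClosure.isIntegral A L x).map (IsScalarTower.toAlgHom A B L))
    rw [Algebra.discr_powerBasis_eq_norm, hgen, aeval_derivative_minpoly_of_cubic h3 hw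
      (cubic_algebraMap h), norm_derivative_of_cubic h3 hw (cubic_algebraMap h)] at hx
    rw [h3, show 3 * (3 - 1) / 2 = 3 by norm_num, Odd.neg_one_pow (by decide),
      neg_one_mul, neg_smul] at hx
    have hΔ := congrArg (algebraMap A K) hm
    simp only [map_add, map_mul, map_pow, map_ofNat] at hΔ
    rw [hΔ] at hx
    simp only [← map_pow, ← map_mul, algebraMap_smul] at hx
    exact neg_mem_iff.mp hx
  -- `π ^ m * u` carries `B` into `A[w]`; the Eisenstein property allows `π ^ m` to be cancelled.
  -- The conductor is therefore prime to `π`.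
  have hcond : algebraMap A B u ∈ conductor A w := by
    rw [mem_conductor_iff]
    intro x
    refine hadj _ ?_
    rw [← hgen]
    refine mem_adjoin_of_smul_prime_pow_smul_of_minpoly_isEisensteinAt (K := K) (n := m) hπ
      (by rwa [hgen])
      ((IsIntegralClosure.isIntegral A L (algebraMap A B u * x)).map
        (IsScalarTower.toAlgHom A B L)) ?_ (by rwa [hgen])
    rw [hgen]
    convert hdisc x using 1
    simp [Algebra.smul_def, mul_assoc, ← IsScalarTower.algebraMap_apply]
  refine ⟨_, _, fun hJ => ?_, fun hJ => ?_, key.trans (by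
    rw [hm, Ideal.span_singleton_pow, ← Ideal.span_singleton_mul_span_singleton])⟩
  · have hle : Ideal.relNorm A (Ideal.span {algebraMap A B u}) ≤ Ideal.span {π} :=
      (Ideal.relNorm_mono A ((Ideal.span_singleton_le_iff_mem _).mpr hcond)).trans hJ
    have hmap : Ideal.span {algebraMap A B u} = (Ideal.span {u}).map (algebraMap A B) := by
      rw [Ideal.map_span, Set.image_singleton]
    rw [hmap, Ideal.relNorm_algebraMap, Ideal.span_singleton_pow,
      Ideal.span_singleton_le_iff_mem, Ideal.mem_span_singleton] at hle
    exact hu (hπ.dvd_of_dvd_pow hle)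
  · rw [Ideal.span_singleton_le_iff_mem, Ideal.mem_span_singleton] at hJ
    exact hu hJ

end LocalExponents

end CubicFunctionField

/-! ### Choice of a generator at each type of prime -/

namespace CubicFunctionField

section StandardForm

theorem eq_zero_of_quadratic_of_finrank_eq_three {K L : Type*} [Field K] [Field L] [Algebra K L]
    (h3 : Module.finrank K L = 3) {y : L} (hy : y ∉ (algebraMap K L).range) {a c d : K}
    (h : algebraMap K L a * y ^ 2 + algebraMap K L c * y + algebraMap K L d = 0) : d = 0 := by
  have : FiniteDimensional K L := Module.finite_of_finrank_pos (by omega)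
  have hint : IsIntegral K y := Algebra.IsIntegral.isIntegral y
  have hp := (PowerBasis.ofAdjoinEqTop hint (adjoin_eq_top_of_finrank_eq_three h3 hy)).finrank
  rw [h3, PowerBasis.ofAdjoinEqTop_dim] at hp
  by_contra hd
  have hne : (⟨0, a, c, d⟩ : Cubic K).toPoly ≠ 0 := fun h0 => hd <| by
    exact (Cubic.coeff_eq_d (P := ⟨0, a, c, d⟩)).symm.trans (by rw [h0, Polynomial.coeff_zero])
  have hle := Polynomial.natDegree_le_of_dvd (minpoly.dvd K y
    (p := (⟨0, a, c, d⟩ : Cubic K).toPoly) (by simpa [Cubic.toPoly] using h)) hne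
  have := Cubic.natDegree_of_a_eq_zero (P := ⟨0, a, c, d⟩) rfl
  omega

variable {A K L : Type*} (B : Type*) [CommRing A] [IsDedekindDomain A] [Field K] [Field L]
  [CommRing B] [IsDedekindDomain B] [Algebra A K] [Algebra A L] [Algebra A B] [Algebra K L]
  [Algebra B L] [IsScalarTower A K L] [IsScalarTower A B L] [IsFractionRing A K]
  [IsIntegralClosure B A L]

omit [IsDedekindDomain A] [IsDedekindDomain B] in
theorem exists_integral_of_cubic {x : L} {a c d : A}
    (h : x ^ 3 + algebraMap A L a * x ^ 2 + algebraMap A L c * x + algebraMap A L d = 0) :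
    ∃ w : B, algebraMap B L w = x ∧
      w ^ 3 + algebraMap A B a * w ^ 2 + algebraMap A B c * w + algebraMap A B d = 0 := by
  have hint : IsIntegral A x :=
    ⟨(⟨1, a, c, d⟩ : Cubic A).toPoly, Cubic.monic_of_a_eq_one rfl, by
      simpa [Cubic.toPoly] using h⟩
  obtain ⟨w, hw⟩ := IsIntegralClosure.isIntegral_iff (A := B).mp hint
  refine ⟨w, hw, IsIntegralClosure.algebraMap_injective B A L ?_⟩
  simpa [← IsScalarTower.algebraMap_apply, hw] using h

variable [CharP K 3] [FiniteDimensional K L] [Algebra.IsSeparable K L]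
  [Module.IsTorsionFree A B] [Module.Finite A B]

theorem hasExponent_zero_of_not_dvd (h3 : Module.finrank K L = 3) {ξ₁ ξ₂ β π : A} (hπ : Prime π)
    {y : L} (hy : y ∉ (algebraMap K L).range)
    (h : y ^ 3 + algebraMap A L (ξ₁ * β) * y + algebraMap A L (ξ₁ ^ 2 * ξ₂ * β) = 0)
    (h₁ : ¬ π ∣ ξ₁) (hβ : ¬ π ∣ β) :
    HasExponent (Ideal.span {π}) (Ideal.relNorm A (differentIdeal A B)) 0 := by
  obtain ⟨w, rfl, hw⟩ := exists_integral_of_cubic B (x := y) (a := 0) (c := ξ₁ * β)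
    (d := ξ₁ ^ 2 * ξ₂ * β) (by simpa using h)
  refine hasExponent_zero_of_discriminant_notMem h3 _ hy hw ?_
  rw [Ideal.mem_span_singleton]
  intro hdvd
  have : π ∣ (ξ₁ * β) ^ 3 := by simpa using hdvd
  exact (hπ.dvd_or_dvd (hπ.dvd_of_dvd_pow this)).elim h₁ hβ

/-- The cubic of `y` is `Y³` modulo `π`, so `y` alone is a poor generator. With `s = βξ₁ξ₂ / y`,
also integral, the element `s + γy` has a cubic congruent to `W²(W + β)`. -/
theorem hasExponent_one_of_dvd (h3 : Module.finrank K L = 3) {ξ₁ ξ₂ β π : A} (hπ : Prime π)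
    {y : L} (hy : y ∉ (algebraMap K L).range)
    (h : y ^ 3 + algebraMap A L (ξ₁ * β) * y + algebraMap A L (ξ₁ ^ 2 * ξ₂ * β) = 0)
    (h₁ : π ∣ ξ₁) (h₁' : ¬ π ^ 2 ∣ ξ₁) (h₁0 : ξ₁ ≠ 0) (h₂0 : ξ₂ ≠ 0) (hβ : ¬ π ∣ β) :
    HasExponent (Ideal.span {π}) (Ideal.relNorm A (differentIdeal A B)) 1 := by
  have hL : CharP L 3 := charP_of_injective_algebraMap (algebraMap K L).injective 3
  have h30 : (3 : L) = 0 := by exact_mod_cast CharP.cast_eq_zero L 3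
  have hy0 : y ≠ 0 := fun h0 => hy ⟨0, by rw [map_zero, h0]⟩
  have hβ0 : β ≠ 0 := fun h0 => hβ (h0 ▸ dvd_zero π)
  -- The constant term for general `γ` is `β²ξ₁(γ - ξ₂)² + γ³βξ₁²ξ₂`. Taking `γ - ξ₂ = 1` makes `π`
  -- divide it exactly once, even when `π ∣ ξ₂`.
  set γ : A := 1 + ξ₂ with hγ
  obtain ⟨s, hs⟩ : ∃ s, s * y = algebraMap A L (β * ξ₁ * ξ₂) :=
    ⟨algebraMap A L (β * ξ₁ * ξ₂) / y, div_mul_cancel₀ _ hy0⟩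
  simp only [map_mul, map_pow] at h hs
  have hy2 : y ^ 2 + algebraMap A L ξ₁ * s + algebraMap A L ξ₁ * algebraMap A L β = 0 := by
    refine (mul_eq_zero.mp ?_).resolve_left hy0
    linear_combination h + algebraMap A L ξ₁ * hs
  have hs2 : s ^ 2 + algebraMap A L β * s + algebraMap A L β * algebraMap A L ξ₂ * y = 0 := by
    refine (mul_eq_zero.mp ?_).resolve_left hy0
    linear_combination (s + algebraMap A L β) * hs + algebraMap A L β * algebraMap A L ξ₂ * hy2
  have hcubic : (s + algebraMap A L γ * y) ^ 3
      + algebraMap A L β * (s + algebraMap A L γ * y) ^ 2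
      + algebraMap A L (β * ξ₁ * γ ^ 2) * (s + algebraMap A L γ * y)
      + algebraMap A L (β ^ 2 * ξ₁ + γ ^ 3 * β * ξ₁ ^ 2 * ξ₂) = 0 := by
    have hγ' : algebraMap A L γ - algebraMap A L ξ₂ = 1 := by simp [hγ]
    simp only [map_mul, map_pow, map_add]
    generalize algebraMap A L γ = g at *
    generalize algebraMap A L ξ₁ = q₁ at *
    generalize algebraMap A L ξ₂ = q₂ at *
    generalize algebraMap A L β = t at *
    linear_combination (s + g * y) * (hs2 + 2 * g * hs + g ^ 2 * hy2)
      + (t * (g - q₂) - g ^ 3 * q₁) * hs - g ^ 2 * q₁ * hs2 + g * t * (g - q₂) * hy2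
      + (g * t * q₁ * q₂ * s + g ^ 2 * t * q₁ * q₂ * y) * h30
      - t ^ 2 * q₁ * (g - q₂ + 1) * hγ'
  have hrange : s + algebraMap A L γ * y ∉ (algebraMap K L).range := by
    rintro ⟨r, hr⟩
    have hd := eq_zero_of_quadratic_of_finrank_eq_three h3 hy (a := algebraMap A K γ) (c := -r)
      (d := algebraMap A K (β * ξ₁ * ξ₂)) (by
        rw [map_neg, hr]
        simp only [← IsScalarTower.algebraMap_apply, map_mul]
        linear_combination -hs)
    rw [map_eq_zero_iff _ (IsFractionRing.injective A K)] at hd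
    exact mul_ne_zero (mul_ne_zero hβ0 h₁0) h₂0 hd
  obtain ⟨w, hw, hcw⟩ := exists_integral_of_cubic B hcubic
  rw [← hw] at hrange
  refine hasExponent_one_of_double_root h3 hπ hrange hcw hβ ?_ ?_ ?_
  · exact (h₁.mul_left β).mul_right _
  · exact dvd_add (h₁.mul_left _) (((dvd_pow h₁ two_ne_zero).mul_left _).mul_right _)
  · rw [dvd_add_left (((pow_dvd_pow_of_dvd h₁ 2).mul_left _).mul_right _)]
    intro hdvd
    exact h₁' ((hπ.pow_dvd_of_dvd_mul_left 2 (fun h => hβ (hπ.dvd_of_dvd_pow h))) hdvd)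

theorem hasExponent_of_pole (h3 : Module.finrank K L = 3) {ξ₁ ξ₂ π u : A} {n : ℕ}
    (hπ : Prime π) {y : L} (hy : y ∉ (algebraMap K L).range)
    (h : y ^ 3 + algebraMap A L (ξ₁ * (π ^ n * u)) * y
      + algebraMap A L (ξ₁ ^ 2 * ξ₂ * (π ^ n * u)) = 0)
    (h₁ : ¬ π ∣ ξ₁) (h₂ : ¬ π ∣ ξ₂) (hu : ¬ π ∣ u) (hn : ¬ 3 ∣ n) :
    HasExponent (Ideal.span {π}) (Ideal.relNorm A (differentIdeal A B)) (n + 2) := by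
  have hy0 : y ≠ 0 := fun h0 => hy ⟨0, by rw [map_zero, h0]⟩
  have hinj : Function.Injective (algebraMap A L) := by
    rw [IsScalarTower.algebraMap_eq A K L]
    exact (algebraMap K L).injective.comp (IsFractionRing.injective A K)
  have hπ0 : algebraMap A L π ≠ 0 := (map_ne_zero_iff _ hinj).mpr hπ.ne_zero
  have hind : ∀ {x : A}, ¬ π ∣ x → ¬ π ^ 2 ∣ π * x := fun hx hdvd => hx <| by
    rwa [pow_two, mul_dvd_mul_iff_left hπ.ne_zero] at hdvd
  have hmul : ∀ {x x' : A}, ¬ π ∣ x → ¬ π ∣ x' → ¬ π ∣ x * x' := fun hx hx' hdvd =>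
    (hπ.dvd_or_dvd hdvd).elim hx hx'
  have hpow : ∀ {x : A} (k : ℕ), ¬ π ∣ x → ¬ π ∣ x ^ k := fun k hx hdvd =>
    hx (hπ.dvd_of_dvd_pow hdvd)
  have hcases : n % 3 = 1 ∨ n % 3 = 2 := by omega
  obtain hn | hn := hcases
  · obtain ⟨k, rfl⟩ : ∃ k, n = 3 * k + 1 := ⟨n / 3, by omega⟩
    -- Here `a = 0` and the discriminant is `c³` up to sign, of exponent `3(k + 1) = n + 2`.
    have hcubic : (y / algebraMap A L π ^ k) ^ 3
        + algebraMap A L 0 * (y / algebraMap A L π ^ k) ^ 2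
        + algebraMap A L (π ^ (k + 1) * (ξ₁ * u)) * (y / algebraMap A L π ^ k)
        + algebraMap A L (π * (ξ₁ ^ 2 * ξ₂ * u)) = 0 := by
      refine mul_left_cancel₀ (pow_ne_zero 3 (pow_ne_zero k hπ0)) ?_
      rw [mul_zero, ← h]
      simp only [map_mul, map_pow, map_zero]
      field_simp
      ring
    have hrange : y / algebraMap A L π ^ k ∉ (algebraMap K L).range := by
      rintro ⟨r, hr⟩
      refine hy ⟨r * algebraMap A K π ^ k, ?_⟩
      rw [map_mul, hr, map_pow, ← IsScalarTower.algebraMap_apply,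
        div_mul_cancel₀ _ (pow_ne_zero k hπ0)]
    obtain ⟨w, hw, hcw⟩ := exists_integral_of_cubic B hcubic
    rw [← hw] at hrange
    exact hasExponent_of_isEisenstein h3 hπ hrange hcw (dvd_zero π)
      ((dvd_pow_self π k.succ_ne_zero).mul_right _) (dvd_mul_right π _)
      (hind (hmul (hmul (hpow 2 h₁) h₂) hu))
      (u := (ξ₁ * u) ^ 3) (by ring) (hpow 3 (hmul h₁ hu))
  · obtain ⟨k, rfl⟩ : ∃ k, n = 3 * k + 2 := ⟨n / 3, by omega⟩
    -- Dividing `y` by `π ^ k` would leave `π²` in the constant term; inverting leaves a single `π`.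
    -- Now `c = 0` and the discriminant is `a³d` up to sign, of exponent `3(k + 1) + 1 = n + 2`.
    set x : L := algebraMap A L (π ^ (k + 1) * u * ξ₁ * ξ₂) / y with hx
    have hcubic : x ^ 3 + algebraMap A L (π ^ (k + 1) * u) * x ^ 2
        + algebraMap A L 0 * x
        + algebraMap A L (π * (u ^ 2 * ξ₁ * ξ₂ ^ 2)) = 0 := by
      refine mul_left_cancel₀ (pow_ne_zero 3 hy0) ?_
      rw [mul_zero, ← mul_zero (algebraMap A L (π * (u ^ 2 * ξ₁ * ξ₂ ^ 2))), ← h, hx]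
      simp only [map_mul, map_pow, map_zero]
      field_simp
      ring
    have hx0 : x ≠ 0 := by
      refine div_ne_zero ((map_ne_zero_iff _ hinj).mpr ?_) hy0
      refine mul_ne_zero (mul_ne_zero (mul_ne_zero (pow_ne_zero _ hπ.ne_zero) ?_) ?_) ?_ <;>
      · rintro rfl
        simp_all
    have hrange : x ∉ (algebraMap K L).range := by
      rintro ⟨r, hr⟩
      refine hy ⟨algebraMap A K (π ^ (k + 1) * u * ξ₁ * ξ₂) / r, ?_⟩
      rw [map_div₀, hr, ← IsScalarTower.algebraMap_apply, div_eq_iff hx0, hx,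
        mul_div_cancel₀ _ hy0]
    obtain ⟨w, hw, hcw⟩ := exists_integral_of_cubic B hcubic
    rw [← hw] at hrange
    exact hasExponent_of_isEisenstein h3 hπ hrange hcw
      ((dvd_pow_self π k.succ_ne_zero).mul_right _) (dvd_zero π) (dvd_mul_right π _)
      (hind (hmul (hmul (hpow 2 hu) h₁) (hpow 2 h₂)))
      (u := u ^ 3 * (u ^ 2 * ξ₁ * ξ₂ ^ 2)) (by ring)
      (hmul (hpow 3 hu) (hmul (hmul (hpow 2 hu) h₁) (hpow 2 h₂)))

end StandardForm

end CubicFunctionField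

/-! ### Comparison of fractional ideals by their exponents -/

namespace CubicFunctionField

open IsDedekindDomain

section Assembly

theorem count_eq_of_hasExponent {A K : Type*} [CommRing A] [IsDedekindDomain A] [Field K]
    [Algebra A K] [IsFractionRing A K] {p : HeightOneSpectrum A} {I : Ideal A} (hI : I ≠ ⊥)
    {n : ℕ} (h : HasExponent p.asIdeal I n) :
    FractionalIdeal.count K p (I : FractionalIdeal A⁰ K) = n := by
  obtain ⟨J, J', hJ, hJ', hmul⟩ := h
  have hne : ∀ {M : Ideal A}, ¬ M ≤ p.asIdeal → M ≠ ⊥ := by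
    rintro M hM rfl
    exact hM bot_le
  have hzero : ∀ {M : Ideal A}, ¬ M ≤ p.asIdeal →
      FractionalIdeal.count K p (M : FractionalIdeal A⁰ K) = 0 := by
    intro M hM
    rw [FractionalIdeal.count_coe K p (hne hM), Nat.cast_eq_zero]
    by_contra h0
    exact hM (Ideal.le_of_dvd ((Associates.count_ne_zero_iff_dvd (hne hM) p.irreducible).mp h0))
  have hcoe : ∀ {M : Ideal A}, M ≠ ⊥ → (M : FractionalIdeal A⁰ K) ≠ 0 := fun hM =>
    FractionalIdeal.coeIdeal_ne_zero.mpr hM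
  have := congrArg (fun M : Ideal A => FractionalIdeal.count K p (M : FractionalIdeal A⁰ K)) hmul
  simp only [FractionalIdeal.coeIdeal_mul, FractionalIdeal.coeIdeal_pow] at this
  rw [FractionalIdeal.count_mul K p (hcoe (hne hJ)) (hcoe hI),
    FractionalIdeal.count_mul K p (pow_ne_zero n (hcoe p.ne_bot)) (hcoe (hne hJ')),
    hzero hJ, hzero hJ', FractionalIdeal.count_pow_self] at this
  simpa using this

theorem eq_of_count_eq {A K : Type*} [CommRing A] [IsDedekindDomain A] [Field K]
    [Algebra A K] [IsFractionRing A K] {I J : FractionalIdeal A⁰ K} (hI : I ≠ 0) (hJ : J ≠ 0)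
    (h : ∀ p : HeightOneSpectrum A, FractionalIdeal.count K p I = FractionalIdeal.count K p J) :
    I = J := by
  rw [← FractionalIdeal.finprod_heightOneSpectrum_factorization' K hI,
    ← FractionalIdeal.finprod_heightOneSpectrum_factorization' K hJ]
  simp only [h]

theorem count_prod_zpow {A K : Type*} [CommRing A] [IsDedekindDomain A] [Field K]
    [Algebra A K] [IsFractionRing A K] [DecidableEq (HeightOneSpectrum A)]
    (S : Finset (HeightOneSpectrum A)) (e : HeightOneSpectrum A → ℤ) (p : HeightOneSpectrum A) :
    FractionalIdeal.count K p (∏ q ∈ S, (q.asIdeal : FractionalIdeal A⁰ K) ^ e q) =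
      if p ∈ S then e p else 0 := by
  rw [FractionalIdeal.count_prod K p _ _ fun q _ =>
    zpow_ne_zero _ (FractionalIdeal.coeIdeal_ne_zero.mpr q.ne_bot)]
  simp [FractionalIdeal.count_zpow, FractionalIdeal.count_maximal]

variable {F : Type*} [Field F]

theorem ord_eq_of_pole {p : FinitePlace F} {π x u : F[X]} {n : ℕ} (hπ : π ≠ 0)
    (hp : p.asIdeal = Ideal.span {π}) (hx : ¬ π ∣ x) (hu : ¬ π ∣ u) :
    ord p (algebraMap F[X] (RatFunc F) x / algebraMap F[X] (RatFunc F) (π ^ n * u)) = -n := by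
  have h1 : ∀ {f : F[X]}, ¬ π ∣ f → p.intValuation f = 1 := fun hf => by
    rwa [HeightOneSpectrum.intValuation_eq_one_iff, hp, Ideal.mem_span_singleton]
  rw [ord, map_div₀, HeightOneSpectrum.valuation_of_algebraMap,
    HeightOneSpectrum.valuation_of_algebraMap, map_mul, map_pow, h1 hx, h1 hu,
    HeightOneSpectrum.intValuation_singleton p hπ hp]
  simp

theorem exists_prime_span (p : FinitePlace F) : ∃ π : F[X], Prime π ∧
    p.asIdeal = Ideal.span {π} := by
  obtain ⟨π, hπ⟩ := (IsPrincipalIdealRing.principal p.asIdeal).principal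
  have hπ' : p.asIdeal = Ideal.span {π} := hπ
  have hπ0 : π ≠ 0 := by
    rintro rfl
    exact p.ne_bot (by simpa using hπ')
  exact ⟨π, (Ideal.span_singleton_prime hπ0).mp (hπ' ▸ p.isPrime), hπ'⟩

end Assembly

end CubicFunctionField

theorem mainTheorem4 {F L : Type*} [Field F] [Finite F] [CharP F 3] [Field L] [Algebra F[X] L]
    [Algebra (RatFunc F) L] [IsScalarTower F[X] (RatFunc F) L]
    [FiniteDimensional (RatFunc F) L] [Algebra.IsSeparable (RatFunc F) L]
    (hcubic : Module.finrank (RatFunc F) L = 3)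
    (b : RatFunc F) (z : L)
    (hgen : IntermediateField.adjoin (RatFunc F) {z} = ⊤)
    (hmin : minpoly (RatFunc F) z =
      Polynomial.X ^ 3 + Polynomial.C b * Polynomial.X + Polynomial.C (b ^ 2))
    (hstd : ∀ q : CubicFunctionField.FinitePlace F,
      0 ≤ CubicFunctionField.ord q b ∨
        (CubicFunctionField.ord q b < 0 ∧ IsCoprime (CubicFunctionField.ord q b) 3))
    (ξ₁ ξ₂ β : F[X]) (hξ₁ : Squarefree ξ₁) (hβ : β ≠ 0) (hcop : IsCoprime (ξ₁ * ξ₂) β)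
    (hb : b = algebraMap F[X] (RatFunc F) (ξ₁ * ξ₂ ^ 2) / algebraMap F[X] (RatFunc F) β) :
    (CubicFunctionField.finiteDiscriminant F L : FractionalIdeal F[X]⁰ (RatFunc F)) =
      (∏ p ∈ CubicFunctionField.placesDividing ξ₁ hξ₁.ne_zero,
          (p.asIdeal : FractionalIdeal F[X]⁰ (RatFunc F))) *
        ∏ p ∈ CubicFunctionField.placesDividing β hβ,
          (p.asIdeal : FractionalIdeal F[X]⁰ (RatFunc F)) ^ (-CubicFunctionField.ord p b + 2) := by
  classical
  have hchar : CharP (RatFunc F) 3 :=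
    charP_of_injective_algebraMap (algebraMap F (RatFunc F)).injective 3
  have hinj : Function.Injective (algebraMap F[X] L) := by
    rw [IsScalarTower.algebraMap_eq F[X] (RatFunc F) L]
    exact (algebraMap (RatFunc F) L).injective.comp (IsFractionRing.injective F[X] (RatFunc F))
  have hz : z ∉ (algebraMap (RatFunc F) L).range := fun h => by
    rw [IntermediateField.adjoin_simple_eq_bot_iff.mpr (IntermediateField.mem_bot.mpr h)] at hgen
    have := IntermediateField.finrank_top' (F := RatFunc F) (E := L)
    rw [← hgen, IntermediateField.finrank_bot] at this
    omega
  have hroot : z ^ 3 + algebraMap (RatFunc F) L b * z + algebraMap (RatFunc F) L b ^ 2 = 0 := by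
    have := minpoly.aeval (RatFunc F) z
    rw [hmin] at this
    simpa using this
  have hb0 : b ≠ 0 := by
    rintro rfl
    have hz0 : z = 0 := by simpa using hroot
    exact hz ⟨0, by rw [map_zero, hz0]⟩
  have hξ₂ : ξ₂ ≠ 0 := by
    rintro rfl
    simp [hb] at hb0
  have hβL : algebraMap F[X] L β ≠ 0 := (map_ne_zero_iff _ hinj).mpr hβ
  have hξ₂L : algebraMap F[X] L ξ₂ ≠ 0 := (map_ne_zero_iff _ hinj).mpr hξ₂
  -- This scaling clears the denominator `β` and removes the superfluous factor `ξ₂³` from the cubic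
  -- of `z`.
  set y : L := algebraMap F[X] L β * z / algebraMap F[X] L ξ₂ with hy
  have hbL : algebraMap (RatFunc F) L b =
      algebraMap F[X] L ξ₁ * algebraMap F[X] L ξ₂ ^ 2 / algebraMap F[X] L β := by
    rw [hb, map_div₀, ← IsScalarTower.algebraMap_apply, ← IsScalarTower.algebraMap_apply,
      map_mul, map_pow]
  have hycubic : y ^ 3 + algebraMap F[X] L (ξ₁ * β) * y
      + algebraMap F[X] L (ξ₁ ^ 2 * ξ₂ * β) = 0 := by
    rw [hbL] at hroot
    refine mul_left_cancel₀ (pow_ne_zero 3 hξ₂L) ?_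
    rw [mul_zero, ← mul_zero (algebraMap F[X] L β ^ 3), ← hroot, hy]
    simp only [map_mul, map_pow]
    field_simp
  have hyrange : y ∉ (algebraMap (RatFunc F) L).range := by
    rintro ⟨r, hr⟩
    refine hz ⟨r * algebraMap F[X] (RatFunc F) ξ₂ / algebraMap F[X] (RatFunc F) β, ?_⟩
    rw [map_div₀, map_mul, hr, ← IsScalarTower.algebraMap_apply,
      ← IsScalarTower.algebraMap_apply, hy]
    field_simp
  have hD : CubicFunctionField.finiteDiscriminant F L ≠ ⊥ := by
    rw [CubicFunctionField.finiteDiscriminant, ne_eq, Ideal.relNorm_eq_bot_iff,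
      ← FractionalIdeal.coeIdeal_inj (K := L), coeIdeal_differentIdeal F[X] (RatFunc F)]
    simp
  refine CubicFunctionField.eq_of_count_eq (FractionalIdeal.coeIdeal_ne_zero.mpr hD) ?_ ?_
  · exact mul_ne_zero
      (Finset.prod_ne_zero_iff.mpr fun p _ => FractionalIdeal.coeIdeal_ne_zero.mpr p.ne_bot)
      (Finset.prod_ne_zero_iff.mpr fun p _ =>
        zpow_ne_zero _ (FractionalIdeal.coeIdeal_ne_zero.mpr p.ne_bot))
  intro p
  obtain ⟨π, hπ, hp⟩ := CubicFunctionField.exists_prime_span p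
  have hmem : ∀ {f : F[X]} {hf : f ≠ 0},
      p ∈ CubicFunctionField.placesDividing f hf ↔ π ∣ f := by
    intro f hf
    rw [CubicFunctionField.mem_placesDividing, hp, Ideal.dvd_span_singleton,
      Ideal.mem_span_singleton]
  have hprod := CubicFunctionField.count_prod_zpow (K := RatFunc F)
    (CubicFunctionField.placesDividing ξ₁ hξ₁.ne_zero) (fun _ => 1) p
  simp only [zpow_one] at hprod
  rw [FractionalIdeal.count_mul (RatFunc F) p
    (Finset.prod_ne_zero_iff.mpr fun p _ => FractionalIdeal.coeIdeal_ne_zero.mpr p.ne_bot)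
    (Finset.prod_ne_zero_iff.mpr fun p _ =>
      zpow_ne_zero _ (FractionalIdeal.coeIdeal_ne_zero.mpr p.ne_bot)),
    CubicFunctionField.count_prod_zpow, hprod]
  simp only [hmem]
  have hnot : π ∣ β → ¬ π ∣ ξ₁ * ξ₂ := fun h h' => hπ.not_isUnit (hcop.isUnit_of_dvd' h' h)
  by_cases hπβ : π ∣ β
  · have h₁ : ¬ π ∣ ξ₁ := fun h => hnot hπβ (h.mul_right _)
    have h₂ : ¬ π ∣ ξ₂ := fun h => hnot hπβ (h.mul_left _)
    obtain ⟨u, hβu, hu⟩ :=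
      (FiniteMultiplicity.of_prime_left hπ hβ).exists_eq_pow_mul_and_not_dvd
    generalize hn : multiplicity π β = n at hβu; clear hn
    subst hβu
    have hord : CubicFunctionField.ord p b = -n := by
      rw [hb]
      refine CubicFunctionField.ord_eq_of_pole hπ.ne_zero hp (fun h => ?_) hu
      exact (hπ.dvd_or_dvd h).elim h₁ fun h => h₂ (hπ.dvd_of_dvd_pow h)
    have hn0 : n ≠ 0 := by
      rintro rfl
      exact hu (by simpa using hπβ)
    -- The standard form of `b` enters only here.
    have hn : ¬ 3 ∣ n := by
      rcases hstd p with h | ⟨-, h⟩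
      · omega
      · rw [hord] at h
        obtain ⟨r, s, hrs⟩ := h
        rintro ⟨k, hk⟩
        rw [hk] at hrs
        push_cast at hrs
        have : 3 * (s - r * k) = 1 := by linear_combination hrs
        omega
    have := CubicFunctionField.hasExponent_of_pole (FunctionField.ringOfIntegers F L)
      hcubic hπ hyrange hycubic h₁ h₂ hu hn
    rw [← hp] at this
    rw [if_neg h₁, if_pos hπβ, zero_add, hord, neg_neg]
    exact_mod_cast CubicFunctionField.count_eq_of_hasExponent hD this
  · rw [if_neg hπβ, add_zero]
    by_cases h₁ : π ∣ ξ₁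
    · rw [if_pos h₁]
      have hsq : ¬ π ^ 2 ∣ ξ₁ := fun h => hπ.not_isUnit (hξ₁ π (by rwa [← pow_two]))
      have := CubicFunctionField.hasExponent_one_of_dvd (FunctionField.ringOfIntegers F L)
        hcubic hπ hyrange hycubic h₁ hsq hξ₁.ne_zero hξ₂ hπβ
      rw [← hp] at this
      exact_mod_cast CubicFunctionField.count_eq_of_hasExponent hD this
    · rw [if_neg h₁]
      have := CubicFunctionField.hasExponent_zero_of_not_dvd (FunctionField.ringOfIntegers F L)
        hcubic hπ hyrange hycubic h₁ hπβ
      rw [← hp] at this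
      exact_mod_cast CubicFunctionField.count_eq_of_hasExponent hD this
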